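/- Let $L$ be a frame, with pseudocomplement $a^\ast=\bigvee\{b\in L\mid a\wedge b=0\}$. For $a,b\in L$ say that $b$ is completely below $a$ if there is a family $(c_r)_{r\in\mathbb{Q}\cap[0,1]}$ in $L$ with $b\le c_0$, $c_1\le a$ and $c_r^\ast\vee c_s=1$ whenever $r<s$; the frame $L$ is completely regular if each $a\in L$ is the join of the elements completely below it. Let $\mathfrak{L}(\overline{\mathbb{R}})$ (the frame of extended reals) be the frame presented by generators $(r,-)$ and $(-,s)$, $r,s\in\mathbb{Q}$, and the relations (r1) $(r,-)\wedge(-,s)=0$ whenever $r\ge s$, (r2) $(r,-)\vee(-,s)=1$ whenever $r<s$, (r3) $(r,-)=\bigvee_{s>r}(s,-)$ for every $r\in\mathbb{Q}$, (r4) $(-,s)=\bigvee_{r<s}(-,r)$ for every $s\in\mathbb{Q}$, and let $\mathfrak{L}(\overline{\mathbb{IR}})$ (the frame of extended partial reals) be the frame presented by the same generators and the relations (r1), (r3), (r4) only. Let $\overline{\mathrm{C}}(L)$ be the set of all frame homomorphisms $f\colon\mathfrak{L}(\overline{\mathbb{R}})\to L$, ordered by $f\le g$ iff $f(r,-)\le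 g(r,-)$ for all $r\in\mathbb{Q}$. Let $\overline{\mathrm{H}}(L)$ be the set of all frame homomorphisms $f\colon\mathfrak{L}(\overline{\mathbb{IR}})\to L$ such that $$f(r,-)^\ast\le f(-,s)\quad\text{and}\quad f(-,s)^\ast\le f(r,-)\qquad\text{for all } r<s \text{ in } \mathbb{Q},$$ ordered by $f\le g$ iff $f(r,-)\le g(r,-)$ and $g(-,s)\le f(-,s)$ for all $r,s\in\mathbb{Q}$. Composition with the canonical homomorphism $\mathfrak{L}(\overline{\mathbb{IR}})\to\mathfrak{L}(\overline{\mathbb{R}})$, which sends each generator to the generator of the same name, gives a map $\overline{\mathrm{C}}(L)\to\overline{\mathrm{H}}(L)$. **Proposition.** Let $L$ be a completely regular frame. Then $\overline{\mathrm{H}}(L)$ is the Dedekind–MacNeille completion of $\overline{\mathrm{C}}(L)$: the poset $\overline{\mathrm{H}}(L)$ is a complete lattice, the canonical map $\overline{\mathrm{C}}(L)\to\overline{\mathrm{H}}(L)$ is an order embedding, and each element of $\overline{\mathrm{H}}(L)$ is a join of elements of the image of $\overline{\mathrm{C}}(L)$ and also a meet of elements of that image. -/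

import Mathlib

namespace PointfreeReals

universe u v

/-! ### Completely regular frames -/

section CompletelyRegular

variable {L : Type u} [Order.Frame L]

/-- `b` is completely below `a`: there is a family `c r`, indexed by the rationals `r` of `[0, 1]`,
with `b ≤ c 0`, `c 1 ≤ a` and `(c r)ᶜ ⊔ c s = ⊤` whenever `r < s`.
Here `ᶜ` is the pseudocomplement of the frame `L`. -/
def CompletelyBelow (b a : L) : Prop :=
  ∃ c : Set.Icc (0 : ℚ) 1 → L, b ≤ c 0 ∧ c 1 ≤ a ∧ ∀ r s, r < s → (c r)ᶜ ⊔ c s = ⊤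

/-- A frame is completely regular if each element is the join of the elements completely below
it. -/
def IsCompletelyRegularFrame (L : Type u) [Order.Frame L] : Prop :=
  ∀ a : L, a = sSup {b : L | CompletelyBelow b a}

end CompletelyRegular

/-! ### Dedekind–MacNeille completions -/

/-- `φ : P → M` is a Dedekind–MacNeille completion of the poset `P`: the poset `M` is a complete
lattice, `φ` is an order embedding, and each element of `M` is both a join and a meet of elements
of the image of `φ`. -/
structure IsDedekindMacNeilleCompletion {P : Type u} {M : Type v} [PartialOrder P] [PartialOrder M]
    (φ : P → M) : Prop where
  exists_isLUB : ∀ S : Set M, ∃ x, IsLUB S x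
  exists_isGLB : ∀ S : Set M, ∃ x, IsGLB S x
  le_iff_le : ∀ a b : P, φ a ≤ φ b ↔ a ≤ b
  join_dense : ∀ x : M, ∃ A : Set P, IsLUB (φ '' A) x
  meet_dense : ∀ x : M, ∃ A : Set P, IsGLB (φ '' A) x

/-! ### Frames presented by generators and relations -/

/-- The free frame on a type `G`: the lower sets of the free meet-semilattice with top on `G`,
which is the type of finite subsets of `G` ordered by reverse inclusion. -/
abbrev FreeFrame (G : Type u) : Type u := LowerSet (Finset G)ᵒᵈ

namespace FreeFrame

variable {G : Type u} {L : Type v} [Order.Frame L]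

/-- The generator of the free frame that belongs to `g`. -/
def of (g : G) : FreeFrame G := LowerSet.Iic (OrderDual.toDual {g})

/-- The extension of a map `G → L` to the free frame on `G`, as a plain function. -/
def liftFun (φ : G → L) (x : FreeFrame G) : L :=
  ⨆ s ∈ x, (OrderDual.ofDual s).inf φ

/-- The extension of a map `G → L` to a frame homomorphism on the free frame on `G`. -/
def lift (φ : G → L) : FrameHom (FreeFrame G) L where
  toFun := liftFun φ
  map_top' := top_le_iff.1 <|
    le_trans (by simp) (le_iSup₂_of_le (OrderDual.toDual (∅ : Finset G))
      (LowerSet.mem_top) le_rfl)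
  map_inf' x y := by
    classical
    refine le_antisymm (le_inf ?_ ?_) ?_
    · exact iSup₂_le fun s hs => le_iSup₂_of_le (f := fun s _ => (OrderDual.ofDual s).inf φ) s
        (LowerSet.mem_inf_iff.1 hs).1 le_rfl
    · exact iSup₂_le fun s hs => le_iSup₂_of_le (f := fun s _ => (OrderDual.ofDual s).inf φ) s
        (LowerSet.mem_inf_iff.1 hs).2 le_rfl
    · unfold liftFun
      rw [iSup₂_inf_eq]
      refine iSup₂_le fun s hs => ?_
      rw [inf_iSup₂_eq]
      refine iSup₂_le fun t ht => ?_
      refine le_iSup₂_of_le (f := fun s _ => (OrderDual.ofDual s).inf φ)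
        (OrderDual.toDual (OrderDual.ofDual s ∪ OrderDual.ofDual t)) ?_ ?_
      · refine LowerSet.mem_inf_iff.2 ⟨x.lower ?_ hs, y.lower ?_ ht⟩
        · exact OrderDual.toDual_le.2 Finset.subset_union_left
        · exact OrderDual.toDual_le.2 Finset.subset_union_right
      · rw [OrderDual.ofDual_toDual, Finset.inf_union]
  map_sSup' A := by
    unfold liftFun
    refine le_antisymm (iSup₂_le fun s hs => ?_) (sSup_le ?_)
    · obtain ⟨x, hx, hsx⟩ := LowerSet.mem_sSup_iff.1 hs
      exact le_trans (le_iSup₂_of_le (f := fun s _ => (OrderDual.ofDual s).inf φ) s hsx le_rfl)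
        (le_sSup ⟨x, hx, rfl⟩)
    · rintro _ ⟨x, hx, rfl⟩
      exact iSup₂_le fun s hs => le_iSup₂_of_le (f := fun s _ => (OrderDual.ofDual s).inf φ) s
        (LowerSet.mem_sSup_iff.2 ⟨x, hx, hs⟩) le_rfl

theorem lift_of (φ : G → L) (g : G) : lift φ (of g) = φ g := by
  change liftFun φ (of g) = φ g
  refine le_antisymm (iSup₂_le fun s hs => ?_) ?_
  · have h : ({g} : Finset G) ⊆ OrderDual.ofDual s :=
      OrderDual.le_toDual.1 (LowerSet.mem_Iic_iff.1 hs)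
    exact Finset.inf_le (h (Finset.mem_singleton_self g))
  · have h : OrderDual.toDual ({g} : Finset G) ∈ of g := LowerSet.mem_Iic_iff.2 le_rfl
    exact (Finset.inf_singleton (f := φ) (b := g)).ge.trans
      (le_iSup₂ (f := fun (s : (Finset G)ᵒᵈ) (_ : s ∈ of g) => (OrderDual.ofDual s).inf φ)
        (OrderDual.toDual ({g} : Finset G)) h)

theorem hom_ext {f h : FrameHom (FreeFrame G) L} (H : ∀ g, f (of g) = h (of g)) : f = h := by
  classical
  have key : ∀ s : Finset G,
      f (LowerSet.Iic (OrderDual.toDual s)) = h (LowerSet.Iic (OrderDual.toDual s)) := by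
    intro s
    induction s using Finset.induction_on with
    | empty =>
      have e : LowerSet.Iic (OrderDual.toDual (∅ : Finset G)) = ⊤ := by
        ext t
        simp
      rw [e, map_top, map_top]
    | insert a s _ ih =>
      have e : LowerSet.Iic (OrderDual.toDual (insert a s)) =
          of a ⊓ LowerSet.Iic (OrderDual.toDual s) := by
        ext t
        simp only [of, LowerSet.coe_Iic, Set.mem_Iic, LowerSet.coe_inf, Set.mem_inter_iff,
          OrderDual.le_toDual, Finset.insert_subset_iff,
          Finset.singleton_subset_iff]
      rw [e, map_inf, map_inf, H, ih]
  ext x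
  have e : x = ⨆ s : {s // s ∈ x}, LowerSet.Iic s.1 := by
    refine le_antisymm (fun s hs => ?_) (iSup_le fun s => LowerSet.Iic_le.2 s.2)
    exact LowerSet.mem_iSup_iff.2 ⟨⟨s, hs⟩, LowerSet.mem_Iic_iff.2 le_rfl⟩
  rw [e, map_iSup, map_iSup]
  exact iSup_congr fun s => key (OrderDual.ofDual s.1)

end FreeFrame

section Presented

variable {G : Type u}

/-- The sublocale of the free frame on `G` that is cut out by the relations `a = b`, for `rel a b`:
the set of all `x` with `a ⇨ x = b ⇨ x` for each of them. -/
def relSublocale (rel : FreeFrame G → FreeFrame G → Prop) : Sublocale (FreeFrame G) where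
  carrier := {x | ∀ a b, rel a b → a ⇨ x = b ⇨ x}
  sInf_mem' A hA a b hab := by
    refine eq_of_forall_le_iff fun c => ?_
    rw [le_himp_iff, le_himp_iff, le_sInf_iff, le_sInf_iff]
    refine forall₂_congr fun x hx => ?_
    rw [← le_himp_iff, ← le_himp_iff, hA hx a b hab]
  himp_mem' c x hx a b hab := by
    rw [himp_left_comm, hx a b hab, himp_left_comm]

/-- The frame presented by the generators `G` and the relations `a = b`, for `rel a b`, between
elements of the free frame on `G`. Its universal property is given by `PresentedFrame.lift`,
`PresentedFrame.lift_of` and `PresentedFrame.hom_ext`. -/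
def PresentedFrame (rel : FreeFrame G → FreeFrame G → Prop) : Type u := relSublocale rel

instance (rel : FreeFrame G → FreeFrame G → Prop) : Order.Frame (PresentedFrame rel) :=
  inferInstanceAs (Order.Frame (relSublocale rel))

namespace PresentedFrame

variable {rel : FreeFrame G → FreeFrame G → Prop} {L : Type v} [Order.Frame L]

/-- The quotient homomorphism from the free frame to the presented frame. -/
def mk (rel : FreeFrame G → FreeFrame G → Prop) : FrameHom (FreeFrame G) (PresentedFrame rel) :=
  (relSublocale rel).restrict

/-- The generator of the presented frame that belongs to `g`. -/
def of (rel : FreeFrame G → FreeFrame G → Prop) (g : G) : PresentedFrame rel :=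
  mk rel (FreeFrame.of g)

theorem mk_surjective : Function.Surjective (mk rel) :=
  (relSublocale rel).giRestrict.l_surjective

theorem mk_eq {a b : FreeFrame G} (hab : rel a b) : mk rel a = mk rel b := by
  refine eq_of_forall_ge_iff fun x => ?_
  have h : a ⇨ x.1 = b ⇨ x.1 := x.2 a b hab
  refine ((relSublocale rel).giRestrict.gc a x).trans
    (Iff.trans ?_ ((relSublocale rel).giRestrict.gc b x).symm)
  rw [← himp_eq_top_iff, ← himp_eq_top_iff, h]

/-- A homomorphism on the free frame does not distinguish elements with the same image in the
presented frame, provided that it respects the relations. -/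
theorem le_of_mk_le (f : FrameHom (FreeFrame G) L) (hf : ∀ a b, rel a b → f a = f b)
    {x y : FreeFrame G} (h : mk rel x ≤ mk rel y) : f x ≤ f y := by
  let w : FreeFrame G := sSup {z | f z ≤ f y}
  have hw : ∀ z, z ≤ w ↔ f z ≤ f y := by
    intro z
    refine ⟨fun hz => (OrderHomClass.mono f hz).trans ?_, fun hz => le_sSup hz⟩
    rw [map_sSup]
    exact sSup_le (by rintro _ ⟨z, hz, rfl⟩; exact hz)
  have hmem : w ∈ relSublocale rel := by
    intro a b hab
    refine eq_of_forall_le_iff fun c => ?_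
    rw [le_himp_iff, le_himp_iff, hw, hw, map_inf, map_inf, hf a b hab]
  have hy : mk rel y ≤ (⟨w, hmem⟩ : relSublocale rel) :=
    ((relSublocale rel).giRestrict.gc y ⟨w, hmem⟩).2 ((hw y).2 le_rfl)
  exact (hw x).1 (((relSublocale rel).giRestrict.gc x ⟨w, hmem⟩).1 (h.trans hy))

theorem eq_of_mk_eq (f : FrameHom (FreeFrame G) L) (hf : ∀ a b, rel a b → f a = f b)
    {x y : FreeFrame G} (h : mk rel x = mk rel y) : f x = f y :=
  le_antisymm (le_of_mk_le f hf h.le) (le_of_mk_le f hf h.ge)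

/-- The homomorphism on the presented frame that is induced by a homomorphism on the free frame
that respects the relations. -/
noncomputable def liftHom (f : FrameHom (FreeFrame G) L) (hf : ∀ a b, rel a b → f a = f b) :
    FrameHom (PresentedFrame rel) L where
  toFun x := f (Function.surjInv mk_surjective x)
  map_top' := by
    rw [← map_top f]
    exact eq_of_mk_eq f hf ((Function.surjInv_eq mk_surjective _).trans (map_top _).symm)
  map_inf' x y := by
    rw [← map_inf f]
    exact eq_of_mk_eq f hf (by rw [map_inf]; simp only [Function.surjInv_eq mk_surjective])
  map_sSup' A := by
    rw [← Set.image_image f (Function.surjInv mk_surjective) A, ← map_sSup f]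
    refine eq_of_mk_eq f hf ?_
    rw [Function.surjInv_eq mk_surjective, map_sSup, Set.image_image]
    simp only [Function.surjInv_eq mk_surjective, Set.image_id']

theorem liftHom_mk (f : FrameHom (FreeFrame G) L) (hf : ∀ a b, rel a b → f a = f b)
    (x : FreeFrame G) : liftHom f hf (mk rel x) = f x :=
  eq_of_mk_eq f hf (Function.surjInv_eq mk_surjective _)

/-- An assignment on the generators that turns the relations into identities in `L` extends to a
frame homomorphism on the presented frame. -/
noncomputable def lift (φ : G → L)
    (hφ : ∀ a b, rel a b → FreeFrame.lift φ a = FreeFrame.lift φ b) :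
    FrameHom (PresentedFrame rel) L :=
  liftHom (FreeFrame.lift φ) hφ

theorem lift_of (φ : G → L) (hφ : ∀ a b, rel a b → FreeFrame.lift φ a = FreeFrame.lift φ b)
    (g : G) : lift φ hφ (of rel g) = φ g :=
  (liftHom_mk _ _ _).trans (FreeFrame.lift_of φ g)

theorem hom_ext {f h : FrameHom (PresentedFrame rel) L}
    (H : ∀ g, f (of rel g) = h (of rel g)) : f = h := by
  have e : f.comp (mk rel) = h.comp (mk rel) := FreeFrame.hom_ext H
  ext x
  obtain ⟨x, rfl⟩ := mk_surjective x
  exact DFunLike.congr_fun e x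

end PresentedFrame

end Presented

/-! ### The frames of extended reals and of extended partial reals -/

/-- The generators `(r, —)` and `(—, s)`, for rational `r` and `s`. -/
inductive RealGen : Type
  | above (r : ℚ)
  | below (s : ℚ)

open FreeFrame RealGen

/-- The defining relations (r1), (r3), (r4) of the frame of extended partial reals. -/
inductive ExtPartialRealRel : FreeFrame RealGen → FreeFrame RealGen → Prop
  | r1 (r s : ℚ) (h : s ≤ r) : ExtPartialRealRel (of (above r) ⊓ of (below s)) ⊥
  | r3 (r : ℚ) : ExtPartialRealRel (of (above r)) (⨆ s : {s : ℚ // r < s}, of (above s.1))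
  | r4 (s : ℚ) : ExtPartialRealRel (of (below s)) (⨆ r : {r : ℚ // r < s}, of (below r.1))

/-- The defining relations (r1)–(r4) of the frame of extended reals. -/
inductive ExtRealRel : FreeFrame RealGen → FreeFrame RealGen → Prop
  | r1 (r s : ℚ) (h : s ≤ r) : ExtRealRel (of (above r) ⊓ of (below s)) ⊥
  | r2 (r s : ℚ) (h : r < s) : ExtRealRel (of (above r) ⊔ of (below s)) ⊤
  | r3 (r : ℚ) : ExtRealRel (of (above r)) (⨆ s : {s : ℚ // r < s}, of (above s.1))
  | r4 (s : ℚ) : ExtRealRel (of (below s)) (⨆ r : {r : ℚ // r < s}, of (below r.1))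

/-- The frame of extended reals. -/
abbrev ExtRealFrame : Type := PresentedFrame ExtRealRel

/-- The frame of extended partial reals. -/
abbrev ExtPartialRealFrame : Type := PresentedFrame ExtPartialRealRel

/-- The canonical homomorphism from the frame of extended partial reals to the frame of extended
reals, which is the identity on generators. -/
noncomputable def extIota : FrameHom ExtPartialRealFrame ExtRealFrame :=
  PresentedFrame.lift (PresentedFrame.of ExtRealRel) (by
    have e : FreeFrame.lift (PresentedFrame.of ExtRealRel) = PresentedFrame.mk ExtRealRel :=
      FreeFrame.hom_ext fun g => FreeFrame.lift_of _ g
    intro a b hab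
    rw [e]
    refine PresentedFrame.mk_eq ?_
    cases hab with
    | r1 r s h => exact ExtRealRel.r1 r s h
    | r3 r => exact ExtRealRel.r3 r
    | r4 s => exact ExtRealRel.r4 s)

/-! ### Extended continuous (partial) real functions on a frame -/

/-- The extended continuous real functions on `L`, that is, the frame homomorphisms from the frame
of extended reals to `L`. -/
structure ExtContinuous (L : Type u) [Order.Frame L] where
  hom : FrameHom ExtRealFrame L

/-- The continuous extended partial real functions on `L`, that is, the frame homomorphisms from
the frame of extended partial reals to `L`. -/
structure ExtPartialContinuous (L : Type u) [Order.Frame L] where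
  hom : FrameHom ExtPartialRealFrame L

variable {L : Type u} [Order.Frame L]

namespace ExtContinuous

/-- `f (r, —)`. -/
def above (f : ExtContinuous L) (r : ℚ) : L := f.hom (PresentedFrame.of ExtRealRel (.above r))

/-- `f (—, s)`. -/
def below (f : ExtContinuous L) (s : ℚ) : L := f.hom (PresentedFrame.of ExtRealRel (.below s))

theorem above_inf_below (f : ExtContinuous L) {r s : ℚ} (h : s ≤ r) :
    f.above r ⊓ f.below s = ⊥ := by
  have := congrArg f.hom (PresentedFrame.mk_eq (ExtRealRel.r1 r s h))
  rwa [map_inf, map_inf, map_bot, map_bot] at this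

theorem above_sup_below (f : ExtContinuous L) {r s : ℚ} (h : r < s) :
    f.above r ⊔ f.below s = ⊤ := by
  have := congrArg f.hom (PresentedFrame.mk_eq (ExtRealRel.r2 r s h))
  rwa [map_sup, map_sup, map_top, map_top] at this

theorem above_eq_iSup (f : ExtContinuous L) (r : ℚ) :
    f.above r = ⨆ s : {s : ℚ // r < s}, f.above s.1 := by
  have := congrArg f.hom (PresentedFrame.mk_eq (ExtRealRel.r3 r))
  rwa [map_iSup, map_iSup] at this

theorem below_eq_iSup (f : ExtContinuous L) (s : ℚ) :
    f.below s = ⨆ r : {r : ℚ // r < s}, f.below r.1 := by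
  have := congrArg f.hom (PresentedFrame.mk_eq (ExtRealRel.r4 s))
  rwa [map_iSup, map_iSup] at this

@[ext]
theorem ext {f g : ExtContinuous L} (h₁ : ∀ r, f.above r = g.above r)
    (h₂ : ∀ s, f.below s = g.below s) : f = g := by
  cases f; cases g
  congr 1
  refine PresentedFrame.hom_ext fun x => ?_
  cases x with
  | above r => exact h₁ r
  | below s => exact h₂ s

theorem below_le_of_above_le {f g : ExtContinuous L} (h : ∀ r, f.above r ≤ g.above r) (s : ℚ) :
    g.below s ≤ f.below s := by
  rw [g.below_eq_iSup]
  refine iSup_le fun r => ?_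
  have h₁ : Disjoint (g.below r.1) (f.above r.1) :=
    (disjoint_iff.2 (g.above_inf_below le_rfl)).symm.mono_right (h r.1)
  exact h₁.le_of_codisjoint (codisjoint_iff.2 (f.above_sup_below r.2))

/-- Extended continuous real functions are ordered by `f ≤ g` iff `f (r, —) ≤ g (r, —)` for all
rational `r`. -/
instance : PartialOrder (ExtContinuous L) where
  le f g := ∀ r, f.above r ≤ g.above r
  le_refl _ _ := le_rfl
  le_trans _ _ _ h₁ h₂ r := (h₁ r).trans (h₂ r)
  le_antisymm _ _ h₁ h₂ := ext (fun r => le_antisymm (h₁ r) (h₂ r))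
    (fun s => le_antisymm (below_le_of_above_le h₂ s) (below_le_of_above_le h₁ s))

end ExtContinuous

namespace ExtPartialContinuous

/-- `f (r, —)`. -/
def above (f : ExtPartialContinuous L) (r : ℚ) : L :=
  f.hom (PresentedFrame.of ExtPartialRealRel (.above r))

/-- `f (—, s)`. -/
def below (f : ExtPartialContinuous L) (s : ℚ) : L :=
  f.hom (PresentedFrame.of ExtPartialRealRel (.below s))

@[ext]
theorem ext {f g : ExtPartialContinuous L} (h₁ : ∀ r, f.above r = g.above r)
    (h₂ : ∀ s, f.below s = g.below s) : f = g := by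
  cases f; cases g
  congr 1
  refine PresentedFrame.hom_ext fun x => ?_
  cases x with
  | above r => exact h₁ r
  | below s => exact h₂ s

/-- Continuous extended partial real functions are ordered by `f ≤ g` iff `f (r, —) ≤ g (r, —)`
and `g (—, s) ≤ f (—, s)` for all rational `r` and `s`. -/
instance : PartialOrder (ExtPartialContinuous L) where
  le f g := (∀ r, f.above r ≤ g.above r) ∧ ∀ s, g.below s ≤ f.below s
  le_refl _ := ⟨fun _ => le_rfl, fun _ => le_rfl⟩
  le_trans _ _ _ h₁ h₂ :=
    ⟨fun r => (h₁.1 r).trans (h₂.1 r), fun s => (h₂.2 s).trans (h₁.2 s)⟩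
  le_antisymm _ _ h₁ h₂ := ext (fun r => le_antisymm (h₁.1 r) (h₂.1 r))
    (fun s => le_antisymm (h₂.2 s) (h₁.2 s))

/-- `f` is Hausdorff continuous if `f (r, —)ᶜ ≤ f (—, s)` and `f (—, s)ᶜ ≤ f (r, —)` whenever
`r < s`, where `ᶜ` is the pseudocomplement of `L`. -/
def IsHausdorff (f : ExtPartialContinuous L) : Prop :=
  ∀ r s : ℚ, r < s → (f.above r)ᶜ ≤ f.below s ∧ (f.below s)ᶜ ≤ f.above r

end ExtPartialContinuous

/-- The poset of Hausdorff continuous extended partial real functions on `L`, with the order of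
`ExtPartialContinuous L`. -/
abbrev ExtHausdorff (L : Type u) [Order.Frame L] : Type u :=
  {f : ExtPartialContinuous L // f.IsHausdorff}

namespace ExtContinuous

/-- The extended partial real function that belongs to an extended real function: composition with
the canonical homomorphism. -/
noncomputable def toPartial (f : ExtContinuous L) : ExtPartialContinuous L :=
  ⟨f.hom.comp extIota⟩

theorem toPartial_above (f : ExtContinuous L) (r : ℚ) : f.toPartial.above r = f.above r :=
  congrArg f.hom (PresentedFrame.lift_of _ _ _)

theorem toPartial_below (f : ExtContinuous L) (s : ℚ) : f.toPartial.below s = f.below s :=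
  congrArg f.hom (PresentedFrame.lift_of _ _ _)

theorem toPartial_isHausdorff (f : ExtContinuous L) : f.toPartial.IsHausdorff := by
  intro r s h
  rw [toPartial_above, toPartial_below]
  exact ⟨disjoint_compl_left.le_of_codisjoint (codisjoint_iff.2 (f.above_sup_below h)),
    disjoint_compl_left.le_of_codisjoint (codisjoint_iff.2 (f.above_sup_below h)).symm⟩

/-- The canonical map from extended continuous real functions to Hausdorff continuous extended
partial real functions. -/
noncomputable def toHausdorff (f : ExtContinuous L) : ExtHausdorff L :=
  ⟨f.toPartial, f.toPartial_isHausdorff⟩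

end ExtContinuous

end PointfreeReals

namespace PointfreeReals

universe u

variable {L : Type u} [Order.Frame L]

/-! Either half of a Hausdorff function determines the other: `f (—, s)` is the join of the `f (r,
—)ᶜ` with `r < s`, and dually. Hence inequalities between such functions can be tested on one half
(`le_of_above_le`, `le_of_below_le`).

For joins, take the pointwise join `x` of the upper halves. It need not be half of a Hausdorff
function, but `(x p)ᶜᶜ` and `(x p)ᶜ`, made continuous in the rational parameter, form one
(`ofAntitone`), and it is the least upper bound. Meets are joins of lower bounds. None of this uses
complete regularity.

Complete regularity gives density. `f (r, —)` is the join of all `b` completely below some `f (s,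
—)` with `s > r`. The interpolating family from `b` to `f (s, —)` is a scale for a continuous `g ≤
f` with `b ≤ g (r, —)` (`CompletelyBelow.exists_above`). Infinite values are allowed, so `g` can be
`-∞` outside `f (s, —)`. The meet statement is dual, with `+∞` (`CompletelyBelow.exists_below`). -/

theorem iSup_gt_eq_iSup_iSup_gt (x : ℚ → L) (r : ℚ) :
    ⨆ s : {s : ℚ // r < s}, x s = ⨆ s : {s : ℚ // r < s}, ⨆ t : {t : ℚ // s.1 < t}, x t := by
  refine le_antisymm (iSup_le fun s => ?_) (iSup_le fun s => iSup_le fun t => ?_)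
  · obtain ⟨p, hp, hps⟩ := exists_between s.2
    exact le_iSup_of_le ⟨p, hp⟩ (le_iSup_of_le ⟨s.1, hps⟩ le_rfl)
  · exact le_iSup_of_le ⟨t.1, s.2.trans t.2⟩ le_rfl

theorem iSup_lt_eq_iSup_iSup_lt (x : ℚ → L) (s : ℚ) :
    ⨆ r : {r : ℚ // r < s}, x r = ⨆ r : {r : ℚ // r < s}, ⨆ t : {t : ℚ // t < r.1}, x t := by
  refine le_antisymm (iSup_le fun r => ?_) (iSup_le fun r => iSup_le fun t => ?_)
  · obtain ⟨p, hp, hps⟩ := exists_between r.2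
    exact le_iSup_of_le ⟨p, hps⟩ (le_iSup_of_le ⟨r.1, hp⟩ le_rfl)
  · exact le_iSup_of_le ⟨t.1, t.2.trans r.2⟩ le_rfl

/-- Disjointness for `q < p` suffices for (r1) even at `r = s`, because the joins only involve `q <
s ≤ r < p`. -/
theorem iSup_gt_inf_iSup_lt_eq_bot {x y : ℚ → L} (h : ∀ p q, q < p → x p ⊓ y q = ⊥) {r s : ℚ}
    (hsr : s ≤ r) : (⨆ p : {p : ℚ // r < p}, x p) ⊓ (⨆ q : {q : ℚ // q < s}, y q) = ⊥ := by
  rw [iSup_inf_eq, eq_bot_iff]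
  refine iSup_le fun p => ?_
  rw [inf_iSup_eq]
  exact iSup_le fun q => (h p q (q.2.trans_le (hsr.trans p.2.le))).le

/-! ### Partial real functions: order on the Hausdorff ones, construction from families -/

namespace ExtPartialContinuous

theorem above_inf_below (f : ExtPartialContinuous L) {r s : ℚ} (h : s ≤ r) :
    f.above r ⊓ f.below s = ⊥ := by
  have := congrArg f.hom (PresentedFrame.mk_eq (ExtPartialRealRel.r1 r s h))
  rwa [map_inf, map_inf, map_bot, map_bot] at this

theorem above_eq_iSup (f : ExtPartialContinuous L) (r : ℚ) :
    f.above r = ⨆ s : {s : ℚ // r < s}, f.above s.1 := by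
  have := congrArg f.hom (PresentedFrame.mk_eq (ExtPartialRealRel.r3 r))
  rwa [map_iSup, map_iSup] at this

theorem below_eq_iSup (f : ExtPartialContinuous L) (s : ℚ) :
    f.below s = ⨆ r : {r : ℚ // r < s}, f.below r.1 := by
  have := congrArg f.hom (PresentedFrame.mk_eq (ExtPartialRealRel.r4 s))
  rwa [map_iSup, map_iSup] at this

theorem above_antitone (f : ExtPartialContinuous L) : Antitone f.above := by
  intro r s h
  rw [f.above_eq_iSup s]
  refine iSup_le fun t => ?_
  rw [f.above_eq_iSup r]
  exact le_iSup_of_le ⟨t.1, h.trans_lt t.2⟩ le_rfl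

theorem below_monotone (f : ExtPartialContinuous L) : Monotone f.below := by
  intro r s h
  rw [f.below_eq_iSup r]
  refine iSup_le fun t => ?_
  rw [f.below_eq_iSup s]
  exact le_iSup_of_le ⟨t.1, t.2.trans_le h⟩ le_rfl

theorem below_le_compl_above (f : ExtPartialContinuous L) (r : ℚ) : f.below r ≤ (f.above r)ᶜ :=
  le_compl_iff_disjoint_left.2 (disjoint_iff.2 (f.above_inf_below le_rfl))

theorem above_le_compl_below (f : ExtPartialContinuous L) (r : ℚ) : f.above r ≤ (f.below r)ᶜ :=
  le_compl_iff_disjoint_right.2 (disjoint_iff.2 (f.above_inf_below le_rfl))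

/-- For `r < s`, `g (—, r) ≤ g (r, —)ᶜ ≤ f (r, —)ᶜ ≤ f (—, s)`. Only the last step needs the
Hausdorff condition, and only for the smaller function. -/
theorem IsHausdorff.le_of_above_le {f g : ExtPartialContinuous L} (hf : f.IsHausdorff)
    (h : ∀ r, f.above r ≤ g.above r) : f ≤ g := by
  refine ⟨h, fun s => ?_⟩
  rw [g.below_eq_iSup]
  exact iSup_le fun r => (g.below_le_compl_above r).trans
    ((compl_le_compl (h r)).trans (hf r s r.2).1)

theorem IsHausdorff.le_of_below_le {f g : ExtPartialContinuous L} (hg : g.IsHausdorff)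
    (h : ∀ s, g.below s ≤ f.below s) : f ≤ g := by
  refine ⟨fun r => ?_, h⟩
  rw [f.above_eq_iSup]
  exact iSup_le fun s => (f.above_le_compl_below s).trans
    ((compl_le_compl (h s)).trans (hg r s s.2).2)

/-- The extended partial real function with `f (r, —) = ⨆ p > r, x p` and
`f (—, s) = ⨆ q < s, y q`. -/
noncomputable def ofScales (x y : ℚ → L) (h : ∀ p q, q < p → x p ⊓ y q = ⊥) :
    ExtPartialContinuous L where
  hom := PresentedFrame.lift
    (fun
      | .above r => ⨆ p : {p : ℚ // r < p}, x p
      | .below s => ⨆ q : {q : ℚ // q < s}, y q) (by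
    intro a b hab
    cases hab with
    | r1 r s hsr =>
      simpa only [map_inf, map_bot, FreeFrame.lift_of] using iSup_gt_inf_iSup_lt_eq_bot h hsr
    | r3 r => simpa only [map_iSup, FreeFrame.lift_of] using iSup_gt_eq_iSup_iSup_gt x r
    | r4 s => simpa only [map_iSup, FreeFrame.lift_of] using iSup_lt_eq_iSup_iSup_lt y s)

theorem ofScales_above (x y : ℚ → L) (h : ∀ p q, q < p → x p ⊓ y q = ⊥) (r : ℚ) :
    (ofScales x y h).above r = ⨆ p : {p : ℚ // r < p}, x p := by
  simp only [above, ofScales, PresentedFrame.lift_of]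

theorem ofScales_below (x y : ℚ → L) (h : ∀ p q, q < p → x p ⊓ y q = ⊥) (s : ℚ) :
    (ofScales x y h).below s = ⨆ q : {q : ℚ // q < s}, y q := by
  simp only [below, ofScales, PresentedFrame.lift_of]

end ExtPartialContinuous

/-! ### Continuous functions from scales -/

namespace ExtContinuous

/-- The extended real function with `f (r, —) = ⨆ p > r, x p` and
`f (—, s) = ⨆ q < s, (x q)ᶜ`. -/
noncomputable def ofScale (x : ℚ → L) (h : ∀ p q, p < q → (x q)ᶜ ⊔ x p = ⊤) :
    ExtContinuous L where
  hom := PresentedFrame.lift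
    (fun
      | .above r => ⨆ p : {p : ℚ // r < p}, x p
      | .below s => ⨆ q : {q : ℚ // q < s}, (x q)ᶜ) (by
    intro a b hab
    cases hab with
    | r1 r s hsr =>
      -- The scale condition at `q < p` makes `x` antitone: `x p ≤ x q`.
      have hd : ∀ p q, q < p → x p ⊓ (x q)ᶜ = ⊥ := fun p q hqp =>
        disjoint_iff.1 (disjoint_compl_right.mono_left
          (disjoint_compl_right.le_of_codisjoint (codisjoint_iff.2 (h q p hqp))))
      simpa only [map_inf, map_bot, FreeFrame.lift_of] using iSup_gt_inf_iSup_lt_eq_bot hd hsr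
    | r2 r s hrs =>
      simp only [map_sup, map_top, FreeFrame.lift_of]
      -- Two intermediate points are needed, since the scale condition only speaks of `p < q`.
      obtain ⟨p, hrp, hps⟩ := exists_between hrs
      obtain ⟨q, hpq, hqs⟩ := exists_between hps
      rw [eq_top_iff, ← h p q hpq, sup_comm]
      exact sup_le_sup (le_iSup_of_le ⟨p, hrp⟩ le_rfl)
        (le_iSup_of_le (f := fun q : {q : ℚ // q < s} => (x q)ᶜ) ⟨q, hqs⟩ le_rfl)
    | r3 r => simpa only [map_iSup, FreeFrame.lift_of] using iSup_gt_eq_iSup_iSup_gt x r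
    | r4 s =>
      simpa only [map_iSup, FreeFrame.lift_of] using iSup_lt_eq_iSup_iSup_lt (fun q => (x q)ᶜ) s)

theorem ofScale_above (x : ℚ → L) (h : ∀ p q, p < q → (x q)ᶜ ⊔ x p = ⊤) (r : ℚ) :
    (ofScale x h).above r = ⨆ p : {p : ℚ // r < p}, x p := by
  simp only [above, ofScale, PresentedFrame.lift_of]

theorem ofScale_below (x : ℚ → L) (h : ∀ p q, p < q → (x q)ᶜ ⊔ x p = ⊤) (s : ℚ) :
    (ofScale x h).below s = ⨆ q : {q : ℚ // q < s}, (x q)ᶜ := by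
  simp only [below, ofScale, PresentedFrame.lift_of]

end ExtContinuous

/-! ### Continuous functions from the completely below relation -/

/-- The strictly increasing map `x ↦ x / (1 + x)` from the positive rationals to the rationals of
`[0, 1]`. -/
def unitParam (x : ℚ) (hx : 0 < x) : Set.Icc (0 : ℚ) 1 :=
  ⟨x / (1 + x), by positivity, by rw [div_le_one (by positivity)]; linarith⟩

theorem unitParam_lt {x y : ℚ} (hx : 0 < x) (hy : 0 < y) (h : x < y) :
    unitParam x hx < unitParam y hy := by
  refine Subtype.mk_lt_mk.2 ?_
  rw [div_lt_div_iff₀ (by positivity) (by positivity)]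
  linarith

theorem unitParam_pos {x : ℚ} (hx : 0 < x) : 0 < unitParam x hx :=
  Subtype.mk_lt_mk.2 (by positivity)

theorem unitParam_lt_one {x : ℚ} (hx : 0 < x) : unitParam x hx < 1 :=
  Subtype.mk_lt_mk.2 (by rw [div_lt_one (by positivity)]; linarith)

theorem le_of_compl_sup_eq_top {a b : L} (h : aᶜ ⊔ b = ⊤) : a ≤ b :=
  disjoint_compl_right.le_of_codisjoint (codisjoint_iff.2 h)

/-- Needed because the scale in `CompletelyBelow.exists_below` consists of pseudocomplements, so
that its lower half consists of joins of double ones. -/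
theorem compl_compl_le_of_compl_sup_eq_top {a b : L} (h : aᶜ ⊔ b = ⊤) : aᶜᶜ ≤ b :=
  disjoint_compl_left.le_of_codisjoint (codisjoint_iff.2 h)

/-- If `b` is completely below `a`, then some extended real function is `-∞` outside `a`, at least
`r` on `b`, and at most `r` everywhere. -/
theorem CompletelyBelow.exists_above {a b : L} (h : CompletelyBelow b a) (r : ℚ) :
    ∃ g : ExtContinuous L, (∀ p, g.above p ≤ a) ∧ (∀ p, r ≤ p → g.above p = ⊥) ∧
      ∀ p, p < r → b ≤ g.above p := by
  obtain ⟨c, hb, ha, hc⟩ := h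
  -- As `p` decreases from `r` to `-∞`, the parameter runs through the open interval `(0, 1)`, so `x
  -- p` grows but stays between `c 0 ≥ b` and `c 1 ≤ a`.
  let x : ℚ → L := fun p => if hp : p < r then c (unitParam (r - p) (sub_pos.2 hp)) else ⊥
  have hx : ∀ p q, p < q → (x q)ᶜ ⊔ x p = ⊤ := by
    intro p q hpq
    by_cases hq : q < r
    · simp only [x, dif_pos hq, dif_pos (hpq.trans hq)]
      exact hc _ _ (unitParam_lt _ _ (by linarith))
    · simp [x, dif_neg hq]
  refine ⟨ExtContinuous.ofScale x hx, fun p => ?_, fun p hp => ?_, fun p hp => ?_⟩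
  · rw [ExtContinuous.ofScale_above]
    refine iSup_le fun q => ?_
    by_cases hq : q.1 < r
    · simp only [x, dif_pos hq]
      exact (le_of_compl_sup_eq_top (hc _ _ (unitParam_lt_one _))).trans ha
    · simp [x, dif_neg hq]
  · rw [ExtContinuous.ofScale_above]
    exact iSup_eq_bot.2 fun q => dif_neg (hp.trans q.2.le).not_gt
  · rw [ExtContinuous.ofScale_above]
    obtain ⟨q, hpq, hqr⟩ := exists_between hp
    refine le_iSup_of_le ⟨q, hpq⟩ ?_
    simp only [x, dif_pos hqr]
    exact hb.trans (le_of_compl_sup_eq_top (hc _ _ (unitParam_pos _)))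

/-- If `b` is completely below `a`, then some extended real function is `+∞` outside `a`, at most
`s` on `b`, and at least `s` everywhere. -/
theorem CompletelyBelow.exists_below {a b : L} (h : CompletelyBelow b a) (s : ℚ) :
    ∃ g : ExtContinuous L, (∀ p, g.below p ≤ a) ∧ (∀ p, p ≤ s → g.below p = ⊥) ∧
      ∀ p, s < p → b ≤ g.below p := by
  obtain ⟨c, hb, ha, hc⟩ := h
  -- Here the lower half must grow from `b` towards `a`, so the scale takes `(c t)ᶜ`, with `t`
  -- increasing in `p`.
  let x : ℚ → L := fun p => if hp : s < p then (c (unitParam (p - s) (sub_pos.2 hp)))ᶜ else ⊤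
  have hx : ∀ p q, p < q → (x q)ᶜ ⊔ x p = ⊤ := by
    intro p q hpq
    by_cases hp : s < p
    · simp only [x, dif_pos hp, dif_pos (hp.trans hpq)]
      rw [eq_top_iff, ← hc _ _ (unitParam_lt (sub_pos.2 hp) (sub_pos.2 (hp.trans hpq))
        (by linarith)), sup_comm]
      exact sup_le_sup_right le_compl_compl _
    · simp [x, dif_neg hp]
  refine ⟨ExtContinuous.ofScale x hx, fun p => ?_, fun p hp => ?_, fun p hp => ?_⟩
  · rw [ExtContinuous.ofScale_below]
    refine iSup_le fun q => ?_
    by_cases hq : s < q.1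
    · simp only [x, dif_pos hq]
      exact (compl_compl_le_of_compl_sup_eq_top (hc _ _ (unitParam_lt_one _))).trans ha
    · simp [x, dif_neg hq]
  · rw [ExtContinuous.ofScale_below]
    refine iSup_eq_bot.2 fun q => ?_
    simp [x, dif_neg (q.2.le.trans hp).not_gt]
  · rw [ExtContinuous.ofScale_below]
    obtain ⟨q, hsq, hqp⟩ := exists_between hp
    refine le_iSup_of_le (f := fun q : {q : ℚ // q < p} => (x q)ᶜ) ⟨q, hqp⟩ ?_
    simp only [x, dif_pos hsq]
    exact (hb.trans (le_of_compl_sup_eq_top (hc _ _ (unitParam_pos _)))).trans le_compl_compl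

/-! ### Completeness and density -/

namespace ExtHausdorff

theorem le_of_above_le {f g : ExtHausdorff L} (h : ∀ r, f.1.above r ≤ g.1.above r) : f ≤ g :=
  f.2.le_of_above_le h

theorem le_of_below_le {f g : ExtHausdorff L} (h : ∀ s, g.1.below s ≤ f.1.below s) : f ≤ g :=
  g.2.le_of_below_le h

/-- The Hausdorff continuous function with `f (r, —) = ⨆ p > r, (x p)ᶜᶜ` and
`f (—, s) = ⨆ q < s, (x q)ᶜ`. -/
noncomputable def ofAntitone (x : ℚ → L) (hx : Antitone x) : ExtHausdorff L where
  val := .ofScales (fun p => (x p)ᶜᶜ) (fun q => (x q)ᶜ) fun _ _ h =>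
    disjoint_iff.1 (disjoint_compl_left.mono_right (compl_le_compl (hx h.le)))
  property r s h := by
    rw [ExtPartialContinuous.ofScales_above, ExtPartialContinuous.ofScales_below]
    -- A single `p` serves both inequalities, because `(x p)ᶜ` and `(x p)ᶜᶜ` are pseudocomplements
    -- of each other.
    obtain ⟨p, hrp, hps⟩ := exists_between h
    have h₁ : (x p)ᶜᶜ ≤ ⨆ p : {p : ℚ // r < p}, (x p)ᶜᶜ :=
      le_iSup (fun p : {p : ℚ // r < p} => (x p)ᶜᶜ) ⟨p, hrp⟩
    have h₂ : (x p)ᶜ ≤ ⨆ q : {q : ℚ // q < s}, (x q)ᶜ :=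
      le_iSup (fun q : {q : ℚ // q < s} => (x q)ᶜ) ⟨p, hps⟩
    exact ⟨(compl_le_compl h₁).trans ((compl_compl_compl _).le.trans h₂),
      (compl_le_compl h₂).trans h₁⟩

theorem ofAntitone_above (x : ℚ → L) (hx : Antitone x) (r : ℚ) :
    (ofAntitone x hx).1.above r = ⨆ p : {p : ℚ // r < p}, (x p)ᶜᶜ := by
  simp only [ofAntitone, ExtPartialContinuous.ofScales_above]

theorem exists_isLUB (S : Set (ExtHausdorff L)) : ∃ f, IsLUB S f := by
  let x : ℚ → L := fun r => ⨆ f ∈ S, f.1.above r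
  have hx : Antitone x := fun r s h => iSup₂_mono fun f _ => f.1.above_antitone h
  refine ⟨ofAntitone x hx, fun f hf => le_of_above_le fun r => ?_, fun g hg =>
    le_of_above_le fun r => ?_⟩
  · rw [ofAntitone_above, f.1.above_eq_iSup]
    exact iSup_mono fun p => (le_iSup₂ (f := fun f (_ : f ∈ S) => f.1.above p.1) f hf).trans
      le_compl_compl
  · rw [ofAntitone_above]
    refine iSup_le fun p => ?_
    have h : x p ≤ g.1.above p := iSup₂_le fun f hf => (hg hf).1 p
    -- Passing through the lower half of `g` absorbs the double pseudocomplement: `(x p)ᶜᶜ ≤ g (—,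
    -- p)ᶜ ≤ g (r, —)`.
    have h' : g.1.below p ≤ (x p)ᶜ :=
      (g.1.below_le_compl_above p).trans (compl_le_compl h)
    exact (compl_le_compl h').trans (g.2 r p p.2).2

theorem exists_isGLB (S : Set (ExtHausdorff L)) : ∃ f, IsGLB S f :=
  (exists_isLUB (lowerBounds S)).imp fun _ => isLUB_lowerBounds.1

theorem isLUB_image_toHausdorff (hL : IsCompletelyRegularFrame L) (f : ExtHausdorff L) :
    IsLUB (ExtContinuous.toHausdorff '' {g | g.toHausdorff ≤ f}) f := by
  refine ⟨by rintro _ ⟨g, hg, rfl⟩; exact hg, fun k hk => le_of_above_le fun r => ?_⟩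
  -- The gap `r < s` is essential: `g` below has `g (s, —) = ⊥`, yet `b ≤ g (r, —)`.
  rw [f.1.above_eq_iSup]
  refine iSup_le fun s => ?_
  rw [hL (f.1.above s)]
  refine sSup_le fun b hb => ?_
  obtain ⟨g, hga, hg, hgb⟩ := hb.exists_above s
  have hgf : g.toHausdorff ≤ f := le_of_above_le fun p => by
    refine (g.toPartial_above p).trans_le ?_
    rcases lt_or_ge p s.1 with hp | hp
    · exact (hga p).trans (f.1.above_antitone hp.le)
    · simp [hg p hp]
  exact (hgb r s.2).trans ((g.toPartial_above r).ge.trans ((hk ⟨g, hgf, rfl⟩).1 r))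

theorem isGLB_image_toHausdorff (hL : IsCompletelyRegularFrame L) (f : ExtHausdorff L) :
    IsGLB (ExtContinuous.toHausdorff '' {g | f ≤ g.toHausdorff}) f := by
  refine ⟨by rintro _ ⟨g, hg, rfl⟩; exact hg, fun k hk => le_of_below_le fun s => ?_⟩
  rw [f.1.below_eq_iSup]
  refine iSup_le fun r => ?_
  rw [hL (f.1.below r)]
  refine sSup_le fun b hb => ?_
  obtain ⟨g, hga, hg, hgb⟩ := hb.exists_below r
  have hgf : f ≤ g.toHausdorff := le_of_below_le fun p => by
    refine (g.toPartial_below p).trans_le ?_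
    rcases lt_or_ge r.1 p with hp | hp
    · exact (hga p).trans (f.1.below_monotone hp.le)
    · simp [hg p hp]
  exact (hgb s r.2).trans ((g.toPartial_below s).ge.trans ((hk ⟨g, hgf, rfl⟩).2 s))

end ExtHausdorff

theorem ExtContinuous.toHausdorff_le_iff (f g : ExtContinuous L) :
    f.toHausdorff ≤ g.toHausdorff ↔ f ≤ g := by
  have h : ∀ r, (f.toHausdorff.1.above r ≤ g.toHausdorff.1.above r) ↔ f.above r ≤ g.above r :=
    fun r => by rw [← f.toPartial_above, ← g.toPartial_above]; rfl
  exact ⟨fun H r => (h r).1 (H.1 r), fun H => ExtHausdorff.le_of_above_le fun r => (h r).2 (H r)⟩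

end PointfreeReals

theorem mainTheorem1 {L : Type*} [Order.Frame L]
    (hL : PointfreeReals.IsCompletelyRegularFrame L) :
    PointfreeReals.IsDedekindMacNeilleCompletion
      (PointfreeReals.ExtContinuous.toHausdorff :
        PointfreeReals.ExtContinuous L → PointfreeReals.ExtHausdorff L) where
  exists_isLUB := PointfreeReals.ExtHausdorff.exists_isLUB
  exists_isGLB := PointfreeReals.ExtHausdorff.exists_isGLB
  le_iff_le := PointfreeReals.ExtContinuous.toHausdorff_le_iff
  join_dense f := ⟨_, PointfreeReals.ExtHausdorff.isLUB_image_toHausdorff hL f⟩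
  meet_dense f := ⟨_, PointfreeReals.ExtHausdorff.isGLB_image_toHausdorff hL f⟩
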